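/- Let $\zeta$ be the Riemann zeta function, and let $\rho$ run over its nontrivial zeros, i.e. the zeros of $\zeta$ in the open strip $0<\operatorname{Re}(s)<1$, each counted with its multiplicity. Then the series of positive terms $\sum_{\rho} \frac{1}{|\rho|^2}$ converges, and the Riemann Hypothesis (every nontrivial zero satisfies $\operatorname{Re}(\rho)=\tfrac12$) holds if and only if $$\sum_{\rho}\frac{1}{|\rho|^2} = 2+\gamma-\log(4\pi),$$ where $\gamma$ is the Euler–Mascheroni constant. -/

import Mathlib

/-- The nontrivial zeros of the Riemann zeta function: its zeros in the open critical strip. -/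
def nontrivialZetaZeros : Set ℂ :=
  {ρ : ℂ | riemannZeta ρ = 0 ∧ 0 < ρ.re ∧ ρ.re < 1}

/-- The multiplicity of a complex number `ρ` as a zero of the Riemann zeta function,
i.e. the order of vanishing of zeta at `ρ`. -/
noncomputable def zetaZeroMultiplicity (ρ : ℂ) : ℕ :=
  analyticOrderNatAt riemannZeta ρ

/-!
The entire function `ξ(s) = s (s - 1) Λ(s)`, where `Λ` is the completed zeta function, satisfies
`ξ(0) = ξ(1) = 1` and `ξ(1 - s) = ξ(s)`, and its zeros are the nontrivial zeros of zeta with the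
same multiplicities.

Since `ξ` has order less than two, the increment of `ξ' / ξ` from `0` to `1` is the limit over
growing discs of the sums of `1 / ρ + 1 / (1 - ρ)` (`tendsto_sum_zeros`). No Hadamard product is
needed: when the zeros in the disc of radius `R` are divided out, the maximum principle bounds the
quotient, and the Borel–Carathéodory theorem and Cauchy's estimates show that its logarithmic
derivative varies by `O(R ^ (p - 2))` between `0` and `1`, for an order bound `p < 2`. By the
functional equation the increment is `2 ξ'(1) = 2 Λ₀(1) = 2 + γ - log (4 π)`, where
`Λ₀(s) = Λ(s) + 1 / s + 1 / (1 - s)`.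

For `ρ` in the critical strip the real part of `1 / ρ + 1 / (1 - ρ)` is
`Re ρ / ‖ρ‖ ^ 2 + (1 - Re ρ) / ‖1 - ρ‖ ^ 2`, which is positive. Hence the limit over discs is an
unconditional sum (`hasSum_zeros_re`), and comparison gives the convergence of the sum of
`1 / ‖ρ‖ ^ 2`. After symmetrising the latter under `ρ ↦ 1 - ρ`, the two sums differ by the sum of
`2 (1 / 2 - Re ρ) ^ 2 / (‖ρ‖ ^ 2 ‖1 - ρ‖ ^ 2)` (`hasSum_zeros_excess`). These terms are
nonnegative, so the difference is zero exactly when all zeros lie on the critical line.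
-/

/-! ### Entire functions of order less than two -/

open Filter Topology in
/-- Removal of finitely many zeros: an entire function is a polynomial with the prescribed zeros
times an entire function which no longer vanishes at these points. -/
lemma exists_entire_eq_prod_mul {f : ℂ → ℂ} (hf : Differentiable ℂ f) (hf0 : ∃ z, f z ≠ 0)
    (Z : Finset ℂ) :
    ∃ g : ℂ → ℂ, Differentiable ℂ g ∧
      (∀ z, f z = (∏ a ∈ Z, (z - a) ^ analyticOrderNatAt f a) * g z) ∧ ∀ a ∈ Z, g a ≠ 0 := by
  classical
  induction Z using Finset.induction_on with
  | empty => exact ⟨f, hf, by simp, by simp⟩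
  | insert a Z ha ih =>
    obtain ⟨g, hg, hfg, hgZ⟩ := ih
    have hfin : analyticOrderAt g a ≠ ⊤ := by
      intro htop
      have h0 : ∀ z, g z = 0 := by
        have := AnalyticOnNhd.eqOn_zero_of_preconnected_of_eventuallyEq_zero
          (hg.differentiableOn.analyticOnNhd isOpen_univ) isPreconnected_univ (Set.mem_univ a)
          (analyticOrderAt_eq_top.mp htop)
        exact fun z => this (Set.mem_univ z)
      obtain ⟨z, hz⟩ := hf0
      exact hz (by rw [hfg, h0, mul_zero])
    have hp : AnalyticAt ℂ (fun z => ∏ b ∈ Z, (z - b) ^ analyticOrderNatAt f b) a := by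
      fun_prop
    have hord : analyticOrderAt f a = analyticOrderAt g a := by
      have h1 : f = (fun z => ∏ b ∈ Z, (z - b) ^ analyticOrderNatAt f b) * g := funext hfg
      have h2 : analyticOrderAt (fun z => ∏ b ∈ Z, (z - b) ^ analyticOrderNatAt f b) a = 0 := by
        rw [hp.analyticOrderAt_eq_zero]
        refine Finset.prod_ne_zero_iff.mpr fun b hb => pow_ne_zero _ (sub_ne_zero.mpr ?_)
        rintro rfl
        exact ha hb
      have h3 := analyticOrderAt_mul hp (hg.analyticAt a)
      rwa [← h1, h2, zero_add] at h3
    set n := analyticOrderNatAt f a with hn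
    have hn' : analyticOrderAt g a = n := by
      rw [hn, analyticOrderNatAt, hord, ENat.natCast_toNat hfin]
    obtain ⟨k, hk, hka, hgk⟩ := (hg.analyticAt a).analyticOrderAt_eq_natCast.mp hn'
    -- the quotient is `k` near `a` and `g / (z - a) ^ n` elsewhere
    refine ⟨Function.update (fun z => g z / (z - a) ^ n) a (k a), ?_, ?_, ?_⟩
    · intro z
      rcases eq_or_ne z a with rfl | hz
      · refine hk.differentiableAt.congr_of_eventuallyEq ?_
        filter_upwards [hgk] with w hw
        rcases eq_or_ne w z with rfl | hwz
        · simp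
        · rw [Function.update_of_ne hwz, hw, smul_eq_mul, mul_div_cancel_left₀]
          exact pow_ne_zero _ (sub_ne_zero.mpr hwz)
      · have : DifferentiableAt ℂ (fun z => g z / (z - a) ^ n) z :=
          (hg z).div (by fun_prop) (pow_ne_zero _ (sub_ne_zero.mpr hz))
        refine this.congr_of_eventuallyEq ?_
        filter_upwards [isOpen_ne.mem_nhds hz] with w hw
        exact Function.update_of_ne hw _ _
    · intro z
      rw [Finset.prod_insert ha, hfg z]
      rcases eq_or_ne z a with rfl | hz
      · rw [Function.update_self, hgk.self_of_nhds, smul_eq_mul]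
        ring
      · have := pow_ne_zero n (sub_ne_zero.mpr hz)
        change _ = (z - a) ^ n * _ * _
        rw [Function.update_of_ne hz]
        field_simp
    · intro b hb
      rcases Finset.mem_insert.mp hb with rfl | hb
      · simpa using hka
      · have hba : b ≠ a := fun h => ha (h ▸ hb)
        rw [Function.update_of_ne hba]
        exact div_ne_zero (hgZ b hb) (pow_ne_zero _ (sub_ne_zero.mpr hba))

open Metric in
/-- A zero-free holomorphic function on a disc about the origin has a holomorphic logarithm there,
up to its value at the origin. -/
lemma exists_log_div_of_ne_zero_on_ball {g : ℂ → ℂ} {R : ℝ} (hR : 0 < R)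
    (hg : DifferentiableOn ℂ g (ball 0 R)) (hg0 : ∀ z ∈ ball 0 R, g z ≠ 0) :
    ∃ L : ℂ → ℂ, L 0 = 0 ∧ (∀ z ∈ ball 0 R, HasDerivAt L (logDeriv g z) z) ∧
      ∀ z ∈ ball 0 R, g z = g 0 * Complex.exp (L z) := by
  have hlog : DifferentiableOn ℂ (logDeriv g) (ball 0 R) :=
    (hg.deriv isOpen_ball).div hg hg0
  obtain ⟨L, hL⟩ := hlog.isExactOn_ball.with_val_at 0 0
  have hL' := hL.2
  refine ⟨L, hL.1, hL', fun z hz => ?_⟩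
  have hderiv : ∀ w ∈ ball (0 : ℂ) R,
      HasDerivAt (fun w => g w * Complex.exp (-L w)) 0 w := by
    intro w hw
    have h1 := (hg.differentiableAt (isOpen_ball.mem_nhds hw)).hasDerivAt
    have h2 := h1.mul (hL' w hw).neg.cexp
    convert! h2 using 1
    have := hg0 w hw
    rw [logDeriv_apply]
    field_simp
    ring
  have hconst := (convex_ball (0 : ℂ) R).is_const_of_fderivWithin_eq_zero (𝕜 := ℂ)
    (f := fun w => g w * Complex.exp (-L w))
    (fun w hw => (hderiv w hw).differentiableAt.differentiableWithinAt)
    (fun w hw => by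
      rw [fderivWithin_of_isOpen isOpen_ball hw]
      ext
      simpa using (hderiv w hw).deriv) hz (mem_ball_self hR)
  simp only [hL.1, neg_zero, Complex.exp_zero, mul_one] at hconst
  rw [← hconst, mul_assoc, ← Complex.exp_add]
  simp

open Metric in
/-- If `g` is zero-free on a large disc and of size at most `exp M` relative to its value at the
centre, then its logarithmic derivative is almost constant near the centre. -/
lemma norm_logDeriv_one_sub_logDeriv_zero_le {g : ℂ → ℂ} {R M : ℝ} (hR : 16 ≤ R) (hM : 0 < M)
    (hg : DifferentiableOn ℂ g (ball 0 R)) (hg0 : ∀ z ∈ ball 0 R, g z ≠ 0)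
    (hgM : ∀ z ∈ ball 0 R, ‖g z‖ ≤ Real.exp M * ‖g 0‖) :
    ‖logDeriv g 1 - logDeriv g 0‖ ≤ 64 * M / R ^ 2 := by
  have hR0 : 0 < R := by linarith
  obtain ⟨L, hL0, hL, hgL⟩ := exists_log_div_of_ne_zero_on_ball hR0 hg hg0
  have hLd : DifferentiableOn ℂ L (ball 0 R) := fun z hz =>
    (hL z hz).differentiableAt.differentiableWithinAt
  have hre : Set.MapsTo L (ball 0 R) {z | z.re ≤ M} := by
    intro z hz
    have h0 : 0 < ‖g 0‖ := norm_pos_iff.mpr (hg0 0 (mem_ball_self hR0))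
    have := hgM z hz
    rw [hgL z hz, norm_mul, Complex.norm_exp, mul_comm] at this
    exact Real.exp_le_exp.mp (le_of_mul_le_mul_right this h0)
  have hL1 : ∀ z : ℂ, ‖z‖ ≤ R / 2 → ‖L z‖ ≤ 2 * M := by
    intro z hz
    have hz' : z ∈ ball (0 : ℂ) R := by rw [mem_ball_zero_iff]; linarith
    refine (Complex.borelCaratheodory_zero hM hLd hre hR0 hz' hL0).trans ?_
    rw [div_le_iff₀ (by linarith)]
    nlinarith
  have hL2 : ∀ z : ℂ, ‖z‖ ≤ R / 4 → ‖logDeriv g z‖ ≤ 8 * M / R := by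
    intro z hz
    have hz' : z ∈ ball (0 : ℂ) R := by rw [mem_ball_zero_iff]; linarith
    have hsub : ∀ w ∈ closedBall z (R / 4), ‖w‖ ≤ R / 2 := by
      intro w hw
      have h1 : ‖w - z‖ ≤ R / 4 := by simpa [dist_eq_norm] using hw
      have h2 : ‖w‖ ≤ ‖w - z‖ + ‖z‖ := norm_le_norm_sub_add w z
      linarith
    rw [← (hL z hz').deriv]
    have := Complex.norm_deriv_le_of_forall_mem_sphere_norm_le (f := L) (c := z) (R := R / 4)
      (C := 2 * M) (by linarith) ?_ (fun w hw => hL1 w (hsub w (sphere_subset_closedBall hw)))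
    · refine this.trans (le_of_eq ?_)
      field_simp
      norm_num
    · refine DifferentiableOn.diffContOnCl (hLd.mono ?_)
      rw [closure_ball _ (by linarith)]
      intro w hw
      rw [mem_ball_zero_iff]
      linarith [hsub w hw]
  have hlogd : DifferentiableOn ℂ (logDeriv g) (ball 0 R) :=
    (hg.deriv isOpen_ball).div hg hg0
  have hL3 : ∀ z ∈ closedBall (0 : ℂ) 1, ‖deriv (logDeriv g) z‖ ≤ 64 * M / R ^ 2 := by
    intro z hz
    rw [mem_closedBall_zero_iff] at hz
    have hsub : ∀ w ∈ closedBall z (R / 8), ‖w‖ ≤ R / 4 := by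
      intro w hw
      have h1 : ‖w - z‖ ≤ R / 8 := by simpa [dist_eq_norm] using hw
      have h2 : ‖w‖ ≤ ‖w - z‖ + ‖z‖ := norm_le_norm_sub_add w z
      linarith
    have := Complex.norm_deriv_le_of_forall_mem_sphere_norm_le (f := logDeriv g) (c := z)
      (R := R / 8) (C := 8 * M / R) (by linarith) ?_
      (fun w hw => hL2 w (hsub w (sphere_subset_closedBall hw)))
    · refine this.trans (le_of_eq ?_)
      field_simp
      norm_num
    · refine DifferentiableOn.diffContOnCl (hlogd.mono ?_)
      rw [closure_ball _ (by linarith)]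
      intro w hw
      rw [mem_ball_zero_iff]
      linarith [hsub w hw]
  have := (convex_closedBall (0 : ℂ) 1).norm_image_sub_le_of_norm_deriv_le (𝕜 := ℂ)
    (f := logDeriv g) (x := 0) (y := 1)
    (fun z hz => hlogd.differentiableAt (isOpen_ball.mem_nhds (by
      rw [mem_closedBall_zero_iff] at hz
      rw [mem_ball_zero_iff]; linarith))) hL3 (by simp) (by simp)
  simpa using this

open Metric in
/-- The finite form of the partial fraction expansion: after the zeros in the disc of radius `R`
are divided out, what remains of the logarithmic derivative barely varies between `0` and `1`. The
bound for the quotient `g` comes from the circle of radius `2 * R`, where each factor `z - a`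
that is divided out is at least as large as `a`. -/
lemma norm_sum_zeros_sub_logDeriv_le {f : ℂ → ℂ} (hf : Differentiable ℂ f) (hf0 : f 0 = 1)
    (hf1 : f 1 ≠ 0) {R M : ℝ} (hR : 16 ≤ R) (hM : 0 < M)
    (hfM : ∀ z, ‖z‖ = 2 * R → ‖f z‖ ≤ Real.exp M)
    (Z : Finset ℂ) (hZ : ∀ a, a ∈ Z ↔ f a = 0 ∧ ‖a‖ ≤ R) :
    ‖∑ a ∈ Z, (analyticOrderNatAt f a : ℂ) * (1 / a + 1 / (1 - a)) -
      (logDeriv f 1 - logDeriv f 0)‖ ≤ 64 * M / R ^ 2 := by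
  have hR0 : 0 < R := by linarith
  obtain ⟨g, hg, hfg, hgZ⟩ := exists_entire_eq_prod_mul hf ⟨1, hf1⟩ Z
  have hgf : ∀ z, f z ≠ 0 → g z ≠ 0 := fun z hz h => hz (by rw [hfg, h, mul_zero])
  have hg00 : g 0 ≠ 0 := hgf 0 (by simp [hf0])
  have hgR : ∀ z ∈ ball (0 : ℂ) R, g z ≠ 0 := by
    intro z hz
    by_cases h : f z = 0
    · exact hgZ z ((hZ z).mpr ⟨h, (mem_ball_zero_iff.mp hz).le⟩)
    · exact hgf z h
  have hsphere : ∀ z : ℂ, ‖z‖ = 2 * R → ‖g z‖ ≤ Real.exp M * ‖g 0‖ := by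
    intro z hz
    have h0 : ‖∏ a ∈ Z, (0 - a) ^ analyticOrderNatAt f a‖ * ‖g 0‖ = 1 := by
      rw [← norm_mul, ← hfg, hf0, norm_one]
    have hle : ‖∏ a ∈ Z, (0 - a) ^ analyticOrderNatAt f a‖ ≤
        ‖∏ a ∈ Z, (z - a) ^ analyticOrderNatAt f a‖ := by
      simp only [norm_prod, norm_pow]
      refine Finset.prod_le_prod (fun _ _ => by positivity) fun a ha => ?_
      have h1 := ((hZ a).mp ha).2
      have h2 := norm_sub_norm_le z a
      gcongr
      rw [zero_sub, norm_neg]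
      linarith
    have hfz := hfM z hz
    rw [hfg, norm_mul] at hfz
    calc ‖g z‖ = ‖∏ a ∈ Z, (0 - a) ^ analyticOrderNatAt f a‖ * ‖g z‖ * ‖g 0‖ := by
          rw [mul_right_comm, h0, one_mul]
      _ ≤ ‖∏ a ∈ Z, (z - a) ^ analyticOrderNatAt f a‖ * ‖g z‖ * ‖g 0‖ := by gcongr
      _ ≤ Real.exp M * ‖g 0‖ := by gcongr
  have hball : ∀ z ∈ ball (0 : ℂ) R, ‖g z‖ ≤ Real.exp M * ‖g 0‖ := by
    intro z hz
    refine Complex.norm_le_of_forall_mem_frontier_norm_le (U := ball 0 (2 * R)) isBounded_ball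
      hg.diffContOnCl (fun w hw => hsphere w ?_) (subset_closure ?_)
    · rw [frontier_ball _ (by linarith)] at hw
      simpa using hw
    · rw [mem_ball_zero_iff] at hz ⊢
      linarith
  have hlog : ∀ z, f z ≠ 0 → logDeriv f z =
      ∑ a ∈ Z, (analyticOrderNatAt f a : ℂ) * (1 / (z - a)) + logDeriv g z := by
    intro z hz
    have hza : ∀ a ∈ Z, z - a ≠ 0 := by
      intro a ha h
      rw [sub_eq_zero.mp h] at hz
      exact hz ((hZ a).mp ha).1
    rw [show f = fun z => (∏ a ∈ Z, (z - a) ^ analyticOrderNatAt f a) * g z from funext hfg,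
      logDeriv_mul z (Finset.prod_ne_zero_iff.mpr fun a ha => pow_ne_zero _ (hza a ha)) (hgf z hz)
        (by fun_prop) (hg z), ← funext hfg, logDeriv_prod]
    · congr 1
      refine Finset.sum_congr rfl fun a ha => ?_
      rw [logDeriv_fun_pow (by fun_prop), logDeriv_apply]
      simp
    · exact fun a ha => pow_ne_zero _ (hza a ha)
    · intro a ha
      fun_prop
  have key : ∑ a ∈ Z, (analyticOrderNatAt f a : ℂ) * (1 / a + 1 / (1 - a)) -
      (logDeriv f 1 - logDeriv f 0) = -(logDeriv g 1 - logDeriv g 0) := by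
    rw [hlog 1 hf1, hlog 0 (by simp [hf0])]
    simp only [mul_add, Finset.sum_add_distrib, zero_sub, one_div, inv_neg, mul_neg,
      Finset.sum_neg_distrib]
    ring
  rw [key, norm_neg]
  exact norm_logDeriv_one_sub_logDeriv_zero_le hR hM hg.differentiableOn hgR hball

open Filter Topology in
/-- Partial fractions for an entire function of order less than two: the sum over its zeros of
`1 / a + 1 / (1 - a)`, taken over growing discs, converges to the increment of the logarithmic
derivative from `0` to `1`. -/
lemma tendsto_sum_zeros {f : ℂ → ℂ} (hf : Differentiable ℂ f) (hf0 : f 0 = 1) (hf1 : f 1 ≠ 0)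
    {C p : ℝ} (hC : 0 < C) (hp0 : 0 < p) (hp : p < 2)
    (hfC : ∀ z, ‖f z‖ ≤ Real.exp (C * (1 + ‖z‖) ^ p))
    (Z : ℝ → Finset ℂ) (hZ : ∀ R a, a ∈ Z R ↔ f a = 0 ∧ ‖a‖ ≤ R) :
    Tendsto (fun R => ∑ a ∈ Z R, (analyticOrderNatAt f a : ℂ) * (1 / a + 1 / (1 - a))) atTop
      (𝓝 (logDeriv f 1 - logDeriv f 0)) := by
  rw [tendsto_iff_norm_sub_tendsto_zero]
  have hlim : Tendsto (fun R : ℝ => 64 * C * 3 ^ p * R ^ (-(2 - p))) atTop (𝓝 0) := by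
    simpa using (tendsto_rpow_neg_atTop (by linarith : 0 < 2 - p)).const_mul (64 * C * 3 ^ p)
  refine squeeze_zero' (Eventually.of_forall fun _ => norm_nonneg _) ?_ hlim
  filter_upwards [eventually_ge_atTop 16] with R hR
  have hR0 : 0 < R := by linarith
  refine (norm_sum_zeros_sub_logDeriv_le hf hf0 hf1 (M := C * (1 + 2 * R) ^ p) hR
    (by positivity) (fun z hz => hz ▸ hfC z) (Z R) (hZ R)).trans ?_
  have h1 : (1 + 2 * R) ^ p ≤ 3 ^ p * R ^ p := by
    rw [← Real.mul_rpow (by norm_num) hR0.le]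
    exact Real.rpow_le_rpow (by positivity) (by linarith) hp0.le
  have h2 : R ^ (-(2 - p)) = R ^ p / R ^ 2 := by
    rw [show -(2 - p) = p - (2 : ℕ) by push_cast; ring, Real.rpow_sub_natCast hR0.ne']
  rw [h2, div_le_iff₀ (by positivity)]
  calc 64 * (C * (1 + 2 * R) ^ p) ≤ 64 * (C * (3 ^ p * R ^ p)) := by gcongr
    _ = _ := by field_simp

/-! ### The xi function -/

/-- Riemann's xi function in the normalisation `ξ(0) = ξ(1) = 1`, that is `s (s - 1) Λ(s)` for
the completed zeta function `Λ`. It is written in terms of Mathlib's entire function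
`completedRiemannZeta₀ s = Λ(s) + 1 / s + 1 / (1 - s)`, which makes it entire by construction. -/
noncomputable def riemannXiEntire (s : ℂ) : ℂ := 1 - s * (1 - s) * completedRiemannZeta₀ s

lemma riemannXiEntire_one_sub (s : ℂ) : riemannXiEntire (1 - s) = riemannXiEntire s := by
  simp only [riemannXiEntire, completedRiemannZeta₀_one_sub]
  ring

lemma differentiable_riemannXiEntire : Differentiable ℂ riemannXiEntire := by
  have := differentiable_completedZeta₀
  unfold riemannXiEntire
  fun_prop

@[simp] lemma riemannXiEntire_zero : riemannXiEntire 0 = 1 := by simp [riemannXiEntire]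

@[simp] lemma riemannXiEntire_one : riemannXiEntire 1 = 1 := by simp [riemannXiEntire]

lemma riemannXiEntire_eq_mul_completedRiemannZeta {s : ℂ} (h0 : s ≠ 0) (h1 : s ≠ 1) :
    riemannXiEntire s = s * (s - 1) * completedRiemannZeta s := by
  have h1' : 1 - s ≠ 0 := sub_ne_zero.mpr h1.symm
  rw [riemannXiEntire, completedRiemannZeta_eq]
  field_simp
  ring

lemma riemannXiEntire_eq_mul_riemannZeta {s : ℂ} (hs : 0 < s.re) (h1 : s ≠ 1) :
    riemannXiEntire s = s * (s - 1) * (Complex.Gammaℝ s * riemannZeta s) := by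
  have h0 : s ≠ 0 := by rintro rfl; simp at hs
  have hG := Complex.Gammaℝ_ne_zero_of_re_pos hs
  rw [riemannXiEntire_eq_mul_completedRiemannZeta h0 h1, riemannZeta_def_of_ne_zero h0]
  field_simp

lemma deriv_riemannXiEntire_one : deriv riemannXiEntire 1 = completedRiemannZeta₀ 1 := by
  have h := (((hasDerivAt_id (1 : ℂ)).mul ((hasDerivAt_id (1 : ℂ)).const_sub 1)).mul
    (differentiable_completedZeta₀ 1).hasDerivAt).const_sub 1
  have h' : HasDerivAt riemannXiEntire (completedRiemannZeta₀ 1) 1 := by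
    convert! h using 1
    simp
  exact h'.deriv

lemma deriv_riemannXiEntire_zero : deriv riemannXiEntire 0 = -completedRiemannZeta₀ 1 := by
  have h := (differentiable_riemannXiEntire (1 - 0)).hasDerivAt.scomp (0 : ℂ)
    ((hasDerivAt_id (0 : ℂ)).const_sub 1)
  have h' : riemannXiEntire ∘ HSub.hSub 1 = riemannXiEntire :=
    funext riemannXiEntire_one_sub
  rw [h'] at h
  rw [h.deriv]
  simp [deriv_riemannXiEntire_one]

/-! ### Growth of the xi function -/

lemma norm_Gamma_le_Gamma_re {s : ℂ} (hs : 0 < s.re) : ‖Complex.Gamma s‖ ≤ Real.Gamma s.re := by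
  rw [Complex.Gamma_eq_integral hs, Complex.GammaIntegral, Real.Gamma_eq_integral hs]
  refine (MeasureTheory.norm_integral_le_integral_norm _).trans (le_of_eq ?_)
  refine MeasureTheory.setIntegral_congr_fun measurableSet_Ioi fun x (hx : 0 < x) => ?_
  simp only [norm_mul, Complex.norm_real, Real.norm_eq_abs, Real.abs_exp]
  rw [Complex.norm_cpow_eq_rpow_re_of_pos hx]
  simp

lemma log_le_two_mul_sqrt {t : ℝ} (ht : 0 < t) : Real.log t ≤ 2 * t ^ (1 / 2 : ℝ) := by
  have := Real.log_le_rpow_div ht.le (ε := 1 / 2) (by norm_num)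
  linarith

lemma Gamma_le_exp {x : ℝ} (hx : 1 ≤ x) :
    Real.Gamma x ≤ Real.exp (2 * (1 + x) ^ (3 / 2 : ℝ)) := by
  set n := ⌈x⌉₊
  have hxn : x ≤ n := Nat.le_ceil x
  have hnx : (n : ℝ) ≤ 1 + x := by linarith [Nat.ceil_lt_add_one (by linarith : 0 ≤ x)]
  have h1 : Real.Gamma x ≤ Real.Gamma (n + 1) := by
    calc Real.Gamma x ≤ x * Real.Gamma x :=
          le_mul_of_one_le_left (Real.Gamma_pos_of_pos (by linarith)).le hx
      _ = Real.Gamma (x + 1) := (Real.Gamma_add_one (by linarith)).symm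
      _ ≤ Real.Gamma (n + 1) := Real.Gamma_strictMonoOn_Ici.monotoneOn
          (by simp only [Set.mem_Ici]; linarith) (by simp only [Set.mem_Ici]; linarith)
          (by linarith)
  have hpos : 0 < 1 + x := by linarith
  rw [Real.Gamma_nat_eq_factorial] at h1
  have h2 : ((n.factorial : ℕ) : ℝ) ≤ (n : ℝ) ^ n := by exact_mod_cast Nat.factorial_le_pow n
  have h3 : (n : ℝ) ^ n ≤ (1 + x) ^ n := pow_le_pow_left₀ (by positivity) hnx n
  refine h1.trans (h2.trans (h3.trans ?_))
  rw [← Real.exp_log (pow_pos hpos n), Real.log_pow]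
  refine Real.exp_le_exp.mpr ?_
  calc (n : ℝ) * Real.log (1 + x) ≤ (1 + x) * (2 * (1 + x) ^ (1 / 2 : ℝ)) :=
        mul_le_mul hnx (log_le_two_mul_sqrt hpos) (Real.log_nonneg (by linarith)) hpos.le
    _ = 2 * (1 + x) ^ (3 / 2 : ℝ) := by
        rw [show (3 / 2 : ℝ) = 1 + 1 / 2 by norm_num, Real.rpow_add hpos, Real.rpow_one]
        ring

lemma exists_norm_riemannZeta_le :
    ∃ K : ℝ, 0 ≤ K ∧ ∀ s : ℂ, 2 ≤ s.re → ‖riemannZeta s‖ ≤ K := by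
  have hsum : Summable fun n : ℕ => 1 / ((n : ℝ) + 1) ^ 2 := by
    simpa using (summable_nat_add_iff 1).mpr (Real.summable_one_div_nat_pow.mpr one_lt_two)
  refine ⟨∑' n : ℕ, 1 / ((n : ℝ) + 1) ^ 2, tsum_nonneg fun n => by positivity, fun s hs => ?_⟩
  rw [zeta_eq_tsum_one_div_nat_add_one_cpow (by linarith)]
  refine tsum_of_norm_bounded hsum.hasSum fun n => ?_
  rw [norm_div, norm_one, show (n + 1 : ℂ) = ((n + 1 : ℕ) : ℂ) by push_cast; rfl,
    Complex.norm_natCast_cpow_of_pos n.succ_pos]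
  push_cast
  have h1 : (1 : ℝ) ≤ n + 1 := by linarith [(n.cast_nonneg : (0 : ℝ) ≤ n)]
  refine one_div_le_one_div_of_le (by positivity) ?_
  rw [← Real.rpow_natCast]
  exact Real.rpow_le_rpow_of_exponent_le h1 (by simpa using hs)

open MeasureTheory in
/-- A Mellin transform converging on both edges of a vertical strip is bounded in the strip. -/
lemma exists_norm_mellin_le {f : ℝ → ℂ} {a b : ℝ} (ha : MellinConvergent f a)
    (hb : MellinConvergent f b) :
    ∃ K : ℝ, ∀ s : ℂ, a ≤ s.re → s.re ≤ b → ‖mellin f s‖ ≤ K := by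
  refine ⟨∫ t in Set.Ioi (0 : ℝ),
    (‖(t : ℂ) ^ ((a : ℂ) - 1) • f t‖ + ‖(t : ℂ) ^ ((b : ℂ) - 1) • f t‖), fun s has hsb => ?_⟩
  refine norm_integral_le_of_norm_le (ha.norm.add hb.norm) ?_
  refine (ae_restrict_iff' measurableSet_Ioi).mpr (Filter.Eventually.of_forall fun t ht => ?_)
  have ht' : 0 < t := ht
  simp only [norm_smul, Complex.norm_cpow_eq_rpow_re_of_pos ht', ← add_mul, Complex.sub_re,
    Complex.ofReal_re, Complex.one_re]
  gcongr
  rcases le_total t 1 with h | h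
  · have := Real.rpow_le_rpow_of_exponent_ge ht' h (by linarith : a - 1 ≤ s.re - 1)
    linarith [Real.rpow_nonneg ht'.le (b - 1)]
  · have := Real.rpow_le_rpow_of_exponent_le h (by linarith : s.re - 1 ≤ b - 1)
    linarith [Real.rpow_nonneg ht'.le (a - 1)]

lemma exists_norm_completedRiemannZeta₀_le :
    ∃ K : ℝ, 0 ≤ K ∧ ∀ s : ℂ, 0 ≤ s.re → s.re ≤ 2 → ‖completedRiemannZeta₀ s‖ ≤ K := by
  set P := HurwitzZeta.hurwitzEvenFEPair 0
  have hconv (s : ℂ) : MellinConvergent P.f_modif s :=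
    (P.isStrongFEPair_toStrongFEPair.hasMellin s).1
  obtain ⟨K, hK⟩ := exists_norm_mellin_le (hconv ((0 : ℝ) : ℂ)) (hconv ((1 : ℝ) : ℂ))
  have key : ∀ s : ℂ, 0 ≤ s.re → s.re ≤ 2 → ‖completedRiemannZeta₀ s‖ ≤ K := by
    intro s h0 h2
    have h : completedRiemannZeta₀ s = mellin P.f_modif (s / 2) / 2 := rfl
    rw [h, norm_div, Complex.norm_ofNat]
    exact (half_le_self (norm_nonneg _)).trans
      (hK (s / 2) (by simp; linarith) (by simp; linarith))
  exact ⟨K, (norm_nonneg _).trans (key 0 (by simp) (by simp)), key⟩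

lemma sq_le_exp {t : ℝ} (ht : 1 ≤ t) : t ^ 2 ≤ Real.exp (4 * t ^ (3 / 2 : ℝ)) := by
  have hpos : 0 < t := by linarith
  rw [← Real.exp_log (pow_pos hpos 2), Real.log_pow]
  refine Real.exp_le_exp.mpr ?_
  have h1 := log_le_two_mul_sqrt hpos
  have h2 : t ^ (1 / 2 : ℝ) ≤ t ^ (3 / 2 : ℝ) :=
    Real.rpow_le_rpow_of_exponent_le ht (by norm_num)
  push_cast
  linarith

lemma exists_norm_riemannXiEntire_le_of_nonneg_re :
    ∃ C : ℝ, 0 < C ∧ ∀ s : ℂ, 0 ≤ s.re →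
      ‖riemannXiEntire s‖ ≤ Real.exp (C * (1 + ‖s‖) ^ (3 / 2 : ℝ)) := by
  obtain ⟨K, hK, hζ⟩ := exists_norm_riemannZeta_le
  obtain ⟨K', hK', hΛ⟩ := exists_norm_completedRiemannZeta₀_le
  refine ⟨6 + K + K', by positivity, fun s hs => ?_⟩
  set t := 1 + ‖s‖ with ht
  have ht1 : 1 ≤ t := by linarith [norm_nonneg s]
  have hT : 1 ≤ t ^ (3 / 2 : ℝ) := Real.one_le_rpow ht1 (by norm_num)
  have hsq : ‖s‖ * (1 + ‖s‖) ≤ t ^ 2 := by rw [ht]; nlinarith [norm_nonneg s]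
  have hsub : ‖1 - s‖ ≤ 1 + ‖s‖ := by simpa using norm_sub_le (1 : ℂ) s
  rcases le_total s.re 2 with h2 | h2
  · calc ‖riemannXiEntire s‖ ≤ 1 + ‖s‖ * ‖1 - s‖ * ‖completedRiemannZeta₀ s‖ := by
          rw [riemannXiEntire]
          refine (norm_sub_le _ _).trans ?_
          simp
      _ ≤ 1 + ‖s‖ * (1 + ‖s‖) * K' := by gcongr; exact hΛ s hs h2
      _ ≤ t ^ 2 * (K' + 1) := by nlinarith
      _ ≤ Real.exp (4 * t ^ (3 / 2 : ℝ)) * Real.exp K' := by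
          gcongr
          · exact sq_le_exp ht1
          · exact Real.add_one_le_exp K'
      _ ≤ Real.exp ((6 + K + K') * t ^ (3 / 2 : ℝ)) := by
          rw [← Real.exp_add]
          refine Real.exp_le_exp.mpr ?_
          nlinarith
  · have h1 : s ≠ 1 := by rintro rfl; norm_num at h2
    have hre : s.re ≤ ‖s‖ := Complex.re_le_norm s
    have hG : ‖Complex.Gammaℝ s‖ ≤ Real.exp (2 * t ^ (3 / 2 : ℝ)) := by
      have hre2 : (s / 2).re = s.re / 2 := by simp
      have hpi : ‖(Real.pi : ℂ) ^ (-s / 2)‖ ≤ 1 := by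
        rw [Complex.norm_cpow_eq_rpow_re_of_pos Real.pi_pos]
        refine Real.rpow_le_one_of_one_le_of_nonpos (by linarith [Real.pi_gt_three]) ?_
        simp
        linarith
      rw [Complex.Gammaℝ_def, norm_mul]
      calc ‖(Real.pi : ℂ) ^ (-s / 2)‖ * ‖Complex.Gamma (s / 2)‖
          ≤ 1 * Real.Gamma (s.re / 2) := by
            gcongr
            rw [← hre2]
            exact norm_Gamma_le_Gamma_re (by rw [hre2]; linarith)
        _ ≤ Real.exp (2 * (1 + s.re / 2) ^ (3 / 2 : ℝ)) := by
            rw [one_mul]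
            exact Gamma_le_exp (by linarith)
        _ ≤ Real.exp (2 * t ^ (3 / 2 : ℝ)) := by
            gcongr
            rw [ht]
            linarith
    rw [riemannXiEntire_eq_mul_riemannZeta (by linarith) h1]
    calc ‖s * (s - 1) * (Complex.Gammaℝ s * riemannZeta s)‖
        = (‖s‖ * ‖1 - s‖) * (‖Complex.Gammaℝ s‖ * ‖riemannZeta s‖) := by
          rw [norm_mul, norm_mul, norm_mul, norm_sub_rev s 1]
      _ ≤ (‖s‖ * (1 + ‖s‖)) * (Real.exp (2 * t ^ (3 / 2 : ℝ)) * K) := by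
          gcongr
          exact hζ s h2
      _ ≤ Real.exp (4 * t ^ (3 / 2 : ℝ)) * (Real.exp (2 * t ^ (3 / 2 : ℝ)) * Real.exp K) := by
          gcongr
          · exact hsq.trans (sq_le_exp ht1)
          · linarith [Real.add_one_le_exp K]
      _ ≤ Real.exp ((6 + K + K') * t ^ (3 / 2 : ℝ)) := by
          rw [← Real.exp_add, ← Real.exp_add]
          refine Real.exp_le_exp.mpr ?_
          nlinarith

/-- The xi function has order less than two; the exponent `3 / 2` is a convenient upper bound for
`‖s‖ log ‖s‖`. -/
lemma exists_norm_riemannXiEntire_le :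
    ∃ C : ℝ, 0 < C ∧ ∀ s : ℂ,
      ‖riemannXiEntire s‖ ≤ Real.exp (C * (1 + ‖s‖) ^ (3 / 2 : ℝ)) := by
  obtain ⟨C, hC, h⟩ := exists_norm_riemannXiEntire_le_of_nonneg_re
  refine ⟨C * 2 ^ (3 / 2 : ℝ), by positivity, fun s => ?_⟩
  have hs := norm_nonneg s
  rw [mul_assoc, ← Real.mul_rpow (by norm_num) (by positivity)]
  rcases le_total 0 s.re with h0 | h0
  · refine (h s h0).trans ?_
    gcongr
    linarith
  · rw [← riemannXiEntire_one_sub]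
    refine (h (1 - s) (by simp; linarith)).trans ?_
    have hsub : ‖1 - s‖ ≤ 1 + ‖s‖ := by simpa using norm_sub_le (1 : ℂ) s
    gcongr
    linarith

/-! ### The zeros of the xi function -/

lemma ne_one_of_mem_nontrivialZetaZeros {ρ : ℂ} (h : ρ ∈ nontrivialZetaZeros) : ρ ≠ 1 := by
  rintro rfl
  simpa using h.2.2

lemma ne_zero_of_mem_nontrivialZetaZeros {ρ : ℂ} (h : ρ ∈ nontrivialZetaZeros) : ρ ≠ 0 := by
  rintro rfl
  simpa using h.2.1

lemma riemannXiEntire_ne_zero_of_one_le_re {s : ℂ} (hs : 1 ≤ s.re) : riemannXiEntire s ≠ 0 := by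
  rcases eq_or_ne s 1 with rfl | h1
  · simp
  · have h0 : s ≠ 0 := by rintro rfl; norm_num at hs
    rw [riemannXiEntire_eq_mul_riemannZeta (by linarith) h1]
    exact mul_ne_zero (mul_ne_zero h0 (sub_ne_zero.mpr h1))
      (mul_ne_zero (Complex.Gammaℝ_ne_zero_of_re_pos (by linarith))
        (riemannZeta_ne_zero_of_one_le_re hs))

lemma riemannXiEntire_eq_zero_iff {s : ℂ} : riemannXiEntire s = 0 ↔ s ∈ nontrivialZetaZeros := by
  constructor
  · intro h
    have h1 : s.re < 1 := by
      by_contra! hre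
      exact riemannXiEntire_ne_zero_of_one_le_re hre h
    have h0 : 0 < s.re := by
      by_contra! hre
      refine riemannXiEntire_ne_zero_of_one_le_re (s := 1 - s) (by simpa using hre) ?_
      rwa [riemannXiEntire_one_sub]
    have hs1 : s ≠ 1 := by rintro rfl; simp at h1
    have hs0 : s ≠ 0 := by rintro rfl; simp at h0
    rw [riemannXiEntire_eq_mul_riemannZeta h0 hs1] at h
    have hG := Complex.Gammaℝ_ne_zero_of_re_pos h0
    refine ⟨?_, h0, h1⟩
    simpa [hs0, hG, sub_ne_zero.mpr hs1] using h
  · intro h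
    rw [riemannXiEntire_eq_mul_riemannZeta h.2.1 (ne_one_of_mem_nontrivialZetaZeros h), h.1]
    simp

lemma one_sub_mem_nontrivialZetaZeros {ρ : ℂ} (h : ρ ∈ nontrivialZetaZeros) :
    1 - ρ ∈ nontrivialZetaZeros := by
  rw [← riemannXiEntire_eq_zero_iff] at h ⊢
  rwa [riemannXiEntire_one_sub]

open Filter Topology in
lemma analyticOrderNatAt_riemannXiEntire {ρ : ℂ} (h : ρ ∈ nontrivialZetaZeros) :
    analyticOrderNatAt riemannXiEntire ρ = zetaZeroMultiplicity ρ := by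
  have h0 := ne_zero_of_mem_nontrivialZetaZeros h
  have h1 := ne_one_of_mem_nontrivialZetaZeros h
  have hG := inv_ne_zero (Complex.Gammaℝ_ne_zero_of_re_pos h.2.1)
  have hζ : AnalyticAt ℂ riemannZeta ρ := analyticOn_riemannZeta ρ h1
  have hξ := differentiable_riemannXiEntire.analyticAt ρ
  have hGa := Complex.differentiable_Gammaℝ_inv.analyticAt ρ
  have hq : AnalyticAt ℂ (fun s : ℂ => s * (s - 1)) ρ := by fun_prop
  -- only the inverse of the Gamma factor is available as an entire function
  have heq : (fun s => (Complex.Gammaℝ s)⁻¹) * riemannXiEntire =ᶠ[𝓝 ρ]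
      (fun s : ℂ => s * (s - 1)) * riemannZeta := by
    filter_upwards [isOpen_ne.mem_nhds h1,
      (isOpen_lt continuous_const Complex.continuous_re).mem_nhds h.2.1] with s hs1 hs0
    have := Complex.Gammaℝ_ne_zero_of_re_pos hs0
    rw [Pi.mul_apply, Pi.mul_apply, riemannXiEntire_eq_mul_riemannZeta hs0 hs1]
    field_simp
  have hord := analyticOrderAt_congr heq
  rw [analyticOrderAt_mul hGa hξ, analyticOrderAt_mul hq hζ,
    hGa.analyticOrderAt_eq_zero.mpr hG,
    hq.analyticOrderAt_eq_zero.mpr (mul_ne_zero h0 (sub_ne_zero.mpr h1)), zero_add,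
    zero_add] at hord
  rw [zetaZeroMultiplicity, analyticOrderNatAt, analyticOrderNatAt, hord]

lemma zetaZeroMultiplicity_one_sub {ρ : ℂ} (h : ρ ∈ nontrivialZetaZeros) :
    zetaZeroMultiplicity (1 - ρ) = zetaZeroMultiplicity ρ := by
  rw [← analyticOrderNatAt_riemannXiEntire h,
    ← analyticOrderNatAt_riemannXiEntire (one_sub_mem_nontrivialZetaZeros h)]
  have hd : HasDerivAt (fun s : ℂ => 1 - s) (-1) ρ := (hasDerivAt_id ρ).const_sub 1
  have := analyticOrderAt_comp_of_deriv_ne_zero (f := riemannXiEntire) (g := fun s : ℂ => 1 - s)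
    (z₀ := ρ) (by fun_prop) (by rw [hd.deriv]; norm_num)
  rw [analyticOrderNatAt, analyticOrderNatAt, ← this]
  congr 2
  exact funext riemannXiEntire_one_sub

lemma zetaZeroMultiplicity_pos {ρ : ℂ} (h : ρ ∈ nontrivialZetaZeros) :
    0 < zetaZeroMultiplicity ρ := by
  rw [← analyticOrderNatAt_riemannXiEntire h, Nat.pos_iff_ne_zero, analyticOrderNatAt, Ne,
    ENat.toNat_eq_zero, not_or]
  have hξ := differentiable_riemannXiEntire
  refine ⟨?_, fun htop => ?_⟩
  · rw [(hξ.analyticAt ρ).analyticOrderAt_eq_zero, not_not]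
    exact riemannXiEntire_eq_zero_iff.mpr h
  · have := AnalyticOnNhd.eqOn_zero_of_preconnected_of_eventuallyEq_zero
      (hξ.differentiableOn.analyticOnNhd isOpen_univ) isPreconnected_univ (Set.mem_univ ρ)
      (analyticOrderAt_eq_top.mp htop) (Set.mem_univ 0)
    simp at this

lemma finite_nontrivialZetaZeros_norm_le (R : ℝ) :
    {a : ℂ | a ∈ nontrivialZetaZeros ∧ ‖a‖ ≤ R}.Finite := by
  refine ((isCompact_closedBall (0 : ℂ) R).inter_riemannZetaZeros_finite).subset ?_
  rintro a ⟨ha, haR⟩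
  exact ⟨mem_closedBall_zero_iff.mpr haR, ha.1⟩

/-- The Riemann hypothesis speaks of all zeros off the negative even integers; these are the zeros
in the critical strip. -/
lemma riemannHypothesis_iff :
    RiemannHypothesis ↔ ∀ ρ ∈ nontrivialZetaZeros, ρ.re = 1 / 2 := by
  constructor
  · intro h ρ hρ
    refine h ρ hρ.1 ?_ (ne_one_of_mem_nontrivialZetaZeros hρ)
    rintro ⟨n, rfl⟩
    have := hρ.2.1
    norm_num at this
    linarith [(n.cast_nonneg : (0 : ℝ) ≤ n)]
  · intro h s hs htriv h1
    refine h s ?_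
    have h0 : s ≠ 0 := by
      rintro rfl
      norm_num [riemannZeta_zero] at hs
    rw [← riemannXiEntire_eq_zero_iff, riemannXiEntire_eq_mul_completedRiemannZeta h0 h1]
    rw [riemannZeta_def_of_ne_zero h0, div_eq_zero_iff] at hs
    rcases hs with hs | hs
    · rw [hs, mul_zero]
    · obtain ⟨n, hn⟩ := Complex.Gammaℝ_eq_zero_iff.mp hs
      rcases n with _ | n
      · simp [h0] at hn
      · exact (htriv ⟨n, by rw [hn]; push_cast; ring⟩).elim

/-! ### Sums over the zeros -/

/-- The real part of `1 / ρ + 1 / (1 - ρ)`; it is positive for `ρ` in the critical strip. -/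
lemma re_one_div_add_one_div_one_sub (ρ : ℂ) :
    (1 / ρ + 1 / (1 - ρ)).re = ρ.re * (1 / ‖ρ‖ ^ 2) + (1 - ρ.re) * (1 / ‖1 - ρ‖ ^ 2) := by
  simp only [Complex.sq_norm, Complex.add_re, one_div, Complex.inv_re, Complex.sub_re,
    Complex.one_re]
  ring

open Filter Topology in
/-- The unconditional evaluation: with multiplicities, the sum over the nontrivial zeros of the
real part of `1 / ρ + 1 / (1 - ρ)` is `2 + γ - log (4 π)`. The terms are positive, so convergence
over discs implies summability. -/
lemma hasSum_zeros_re :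
    HasSum (fun ρ : nontrivialZetaZeros =>
      (zetaZeroMultiplicity (ρ : ℂ) : ℝ) * (1 / (ρ : ℂ) + 1 / (1 - (ρ : ℂ))).re)
      (2 + Real.eulerMascheroniConstant - Real.log (4 * Real.pi)) := by
  classical
  set u : ℂ → ℝ := fun ρ => (zetaZeroMultiplicity ρ : ℝ) * (1 / ρ + 1 / (1 - ρ)).re with hu
  set Z : ℝ → Finset ℂ := fun R => (finite_nontrivialZetaZeros_norm_le R).toFinset with hZdef
  have hZ : ∀ R a, a ∈ Z R ↔ a ∈ nontrivialZetaZeros ∧ ‖a‖ ≤ R := by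
    intro R a
    simp [hZdef]
  have hnonneg : ∀ ρ : nontrivialZetaZeros, 0 ≤ u ρ := by
    rintro ⟨ρ, hρ⟩
    have h0 := hρ.2.1
    have h1 : 0 < 1 - ρ.re := sub_pos.mpr hρ.2.2
    simp only [hu, re_one_div_add_one_div_one_sub]
    positivity
  obtain ⟨C, hC, hgrowth⟩ := exists_norm_riemannXiEntire_le
  have hlim := tendsto_sum_zeros differentiable_riemannXiEntire riemannXiEntire_zero (by simp)
    hC (by norm_num) (by norm_num) hgrowth Z
    (fun R a => by rw [hZ, riemannXiEntire_eq_zero_iff])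
  have hval : logDeriv riemannXiEntire 1 - logDeriv riemannXiEntire 0 =
      ((2 + Real.eulerMascheroniConstant - Real.log (4 * Real.pi) : ℝ) : ℂ) := by
    simp only [logDeriv_apply, riemannXiEntire_zero, riemannXiEntire_one, div_one,
      deriv_riemannXiEntire_one, deriv_riemannXiEntire_zero, completedRiemannZeta₀_one]
    push_cast [Complex.ofReal_log (by positivity : 0 ≤ 4 * Real.pi)]
    ring
  rw [hval] at hlim
  have hlim' : Tendsto (fun R => ∑ a ∈ Z R, u a) atTop
      (𝓝 (2 + Real.eulerMascheroniConstant - Real.log (4 * Real.pi))) := by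
    have := (Complex.continuous_re.tendsto _).comp hlim
    rw [Complex.ofReal_re] at this
    refine this.congr fun R => ?_
    rw [Function.comp_apply, Complex.re_sum]
    refine Finset.sum_congr rfl fun a ha => ?_
    rw [analyticOrderNatAt_riemannXiEntire ((hZ R a).mp ha).1, ← Complex.ofReal_natCast,
      Complex.re_ofReal_mul]
  set F : ℝ → Finset nontrivialZetaZeros := fun R => (Z R).subtype (· ∈ nontrivialZetaZeros)
  have hF : Tendsto F atTop atTop := by
    refine tendsto_atTop_finset_of_monotone (fun R R' hRR' ρ hρ => ?_) fun ρ => ⟨‖(ρ : ℂ)‖, ?_⟩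
    · simp only [F, Finset.mem_subtype, hZ] at hρ ⊢
      exact ⟨hρ.1, hρ.2.trans hRR'⟩
    · simp only [F, Finset.mem_subtype, hZ]
      exact ⟨ρ.2, le_rfl⟩
  have hsumF : ∀ R, ∑ ρ ∈ F R, u ρ = ∑ a ∈ Z R, u a := fun R =>
    Finset.sum_subtype_of_mem u fun a ha => ((hZ R a).mp ha).1
  have hle : ∀ s : Finset nontrivialZetaZeros,
      ∑ ρ ∈ s, u ρ ≤ 2 + Real.eulerMascheroniConstant - Real.log (4 * Real.pi) := by
    intro s
    refine ge_of_tendsto hlim' ?_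
    filter_upwards [hF.eventually_ge_atTop s] with R hR
    rw [← hsumF]
    exact Finset.sum_le_sum_of_subset_of_nonneg hR fun ρ _ _ => hnonneg ρ
  have hsum : Summable fun ρ : nontrivialZetaZeros => u ρ := summable_of_sum_le hnonneg hle
  have htend := hsum.hasSum.comp hF
  have : ∑' ρ : nontrivialZetaZeros, u ρ = _ :=
    tendsto_nhds_unique htend (hlim'.congr fun R => (hsumF R).symm)
  exact this ▸ hsum.hasSum

lemma summable_zeros :
    Summable (fun ρ : nontrivialZetaZeros =>
      (zetaZeroMultiplicity (ρ : ℂ) : ℝ) * (1 / ‖(ρ : ℂ)‖ ^ 2)) := by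
  -- away from `0` the terms are at most nine times those of the positive series
  refine Summable.of_norm_bounded_eventually (hasSum_zeros_re.summable.mul_left 9) ?_
  have hfin : {ρ : nontrivialZetaZeros | ‖(ρ : ℂ)‖ ≤ 1}.Finite := by
    refine ((finite_nontrivialZetaZeros_norm_le 1).preimage
      Subtype.val_injective.injOn).subset fun ρ hρ => ⟨ρ.2, hρ⟩
  filter_upwards [hfin.compl_mem_cofinite] with ⟨ρ, hρ⟩ hn
  simp only [Set.mem_compl_iff, Set.mem_ofPred_eq, not_le] at hn
  have h0 := hρ.2.1
  have h1 : 0 < 1 - ρ.re := sub_pos.mpr hρ.2.2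
  have hsub : ‖1 - ρ‖ ≤ 3 * ‖ρ‖ := by
    have := norm_sub_le (1 : ℂ) ρ
    rw [norm_one] at this
    linarith
  have hpos : 0 < ‖1 - ρ‖ :=
    norm_pos_iff.mpr (sub_ne_zero.mpr (ne_one_of_mem_nontrivialZetaZeros hρ).symm)
  have hle : 1 / ‖ρ‖ ^ 2 ≤ 9 * (1 / ‖1 - ρ‖ ^ 2) := by
    rw [mul_one_div, div_le_div_iff₀ (by positivity) (by positivity)]
    nlinarith
  rw [Real.norm_of_nonneg (by positivity), re_one_div_add_one_div_one_sub, mul_left_comm]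
  gcongr
  have hpos' : 0 ≤ 1 / ‖ρ‖ ^ 2 := by positivity
  nlinarith

/-- The involution `ρ ↦ 1 - ρ` of the set of nontrivial zeros. -/
def nontrivialZetaZerosReflection : nontrivialZetaZeros ≃ nontrivialZetaZeros where
  toFun ρ := ⟨1 - ρ, one_sub_mem_nontrivialZetaZeros ρ.2⟩
  invFun ρ := ⟨1 - ρ, one_sub_mem_nontrivialZetaZeros ρ.2⟩
  left_inv ρ := by ext; simp
  right_inv ρ := by ext; simp

/-- The excess of the symmetrised term for `1 / ‖ρ‖ ^ 2` over the corresponding term of the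
unconditional sum; it vanishes exactly on the critical line. -/
lemma half_add_sub_re_eq {ρ : ℂ} (h0 : ρ ≠ 0) (h1 : ρ ≠ 1) :
    (1 / ‖ρ‖ ^ 2 + 1 / ‖1 - ρ‖ ^ 2) / 2 - (1 / ρ + 1 / (1 - ρ)).re =
      2 * (1 / 2 - ρ.re) ^ 2 / (‖ρ‖ ^ 2 * ‖1 - ρ‖ ^ 2) := by
  have hρ : ‖ρ‖ ^ 2 ≠ 0 := pow_ne_zero _ (norm_ne_zero_iff.mpr h0)
  have hρ' : ‖1 - ρ‖ ^ 2 ≠ 0 := pow_ne_zero _ (norm_ne_zero_iff.mpr (sub_ne_zero.mpr h1.symm))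
  have hdiff : ‖1 - ρ‖ ^ 2 = ‖ρ‖ ^ 2 + (1 - 2 * ρ.re) := by
    simp only [Complex.sq_norm, Complex.normSq_apply, Complex.sub_re, Complex.sub_im,
      Complex.one_re, Complex.one_im]
    ring
  rw [re_one_div_add_one_div_one_sub]
  generalize ‖ρ‖ ^ 2 = a at *
  generalize ‖1 - ρ‖ ^ 2 = b at *
  field_simp
  linear_combination (1 - 2 * ρ.re) * hdiff

/-- The sum of `1 / ‖ρ‖ ^ 2` exceeds `2 + γ - log (4 π)` by a sum of nonnegative terms measuring
the distances of the zeros from the critical line. -/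
lemma hasSum_zeros_excess :
    HasSum (fun ρ : nontrivialZetaZeros => (zetaZeroMultiplicity (ρ : ℂ) : ℝ) *
        (2 * (1 / 2 - (ρ : ℂ).re) ^ 2 / (‖(ρ : ℂ)‖ ^ 2 * ‖1 - (ρ : ℂ)‖ ^ 2)))
      (∑' ρ : nontrivialZetaZeros,
          (zetaZeroMultiplicity (ρ : ℂ) : ℝ) * (1 / ‖(ρ : ℂ)‖ ^ 2) -
        (2 + Real.eulerMascheroniConstant - Real.log (4 * Real.pi))) := by
  have hs := summable_zeros.hasSum
  have hs' := (nontrivialZetaZerosReflection.hasSum_iff).mpr hs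
  have h := ((hs.add hs').div_const 2).sub hasSum_zeros_re
  rw [add_self_div_two] at h
  refine h.congr_fun ?_
  rintro ⟨ρ, hρ⟩
  rw [← half_add_sub_re_eq (ne_zero_of_mem_nontrivialZetaZeros hρ)
    (ne_one_of_mem_nontrivialZetaZeros hρ)]
  simp only [Function.comp_apply, nontrivialZetaZerosReflection, Equiv.coe_fn_mk,
    zetaZeroMultiplicity_one_sub hρ]
  ring

theorem mainTheorem12 :
    Summable (fun ρ : nontrivialZetaZeros =>
      (zetaZeroMultiplicity (ρ : ℂ) : ℝ) * (1 / ‖(ρ : ℂ)‖ ^ 2)) ∧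
    (RiemannHypothesis ↔
      ∑' ρ : nontrivialZetaZeros,
          (zetaZeroMultiplicity (ρ : ℂ) : ℝ) * (1 / ‖(ρ : ℂ)‖ ^ 2) =
        2 + Real.eulerMascheroniConstant - Real.log (4 * Real.pi)) := by
  refine ⟨summable_zeros, ?_⟩
  have hexc := hasSum_zeros_excess
  rw [riemannHypothesis_iff, ← sub_eq_zero]
  constructor
  · intro h
    refine hexc.unique (hasSum_zero.congr_fun fun ρ => ?_)
    simp [h ρ ρ.2]
  · intro h ρ hρ
    rw [h, hasSum_zero_iff_of_nonneg fun ρ => by positivity] at hexc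
    have hm : (zetaZeroMultiplicity ρ : ℝ) ≠ 0 := by
      exact_mod_cast (zetaZeroMultiplicity_pos hρ).ne'
    have h0 := ne_zero_of_mem_nontrivialZetaZeros hρ
    have h1 := sub_ne_zero.mpr (ne_one_of_mem_nontrivialZetaZeros hρ).symm
    have := congrFun hexc ⟨ρ, hρ⟩
    simp only [Pi.zero_apply, mul_eq_zero, div_eq_zero_iff, hm, pow_eq_zero_iff two_ne_zero,
      norm_eq_zero, h0, h1, OfNat.ofNat_ne_zero, false_or, or_false] at this
    linarith
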